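/- Let $\mathbb K=\mathbb R$ or $\mathbb C$. A \emph{Saks space} is a triple $(X,\|\cdot\|,\tau)$ where $(X,\|\cdot\|)$ is a normed space over $\mathbb K$ and $\tau$ is a Hausdorff locally convex topology on $X$, coarser than the norm topology $\tau_{\|\cdot\|}$, which is generated by a directed system $\Gamma_\tau$ of continuous seminorms with $\|x\|=\sup_{q\in\Gamma_\tau}q(x)$ for all $x\in X$. Its \emph{mixed topology} $\gamma$ is the finest linear topology on $X$ that coincides with $\tau$ on $\|\cdot\|$-bounded sets and satisfies $\tau\le\gamma\le\tau_{\|\cdot\|}$. The Saks space is \emph{semi-reflexive} if $(X,\gamma)$ is semi-reflexive, i.e. if the canonical map from $X$ to the dual of the strong dual $(X,\gamma)'_b$ is surjective. An \emph{isometric Banach predual} of a normed space $X$ is a pair $(Y,\varphi)$ of a Banach space $Y$ and an isometric isomorphism $\varphi\colon X\to Y^*$. We say that $X$ has a \emph{strongly unique isometric Banach predual} if it has an isometric Banach predual and if for all isometric Banach preduals $(Y,\varphi)$, $(Z,\psi)$ of $X$ and every isometric isomorphism $\alpha\colon Z^*\to Y^*$ there is an isometric isomorphism $\lambda\colon Y\to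 Z$ whose dual map is $\lambda^t=\alpha$. Let $(\mathcal F,\|\cdot\|,\tau)$ be a semi-reflexive Saks space of $\mathbb K$-valued functions on a non-empty set $\Omega$ such that $\tau$ is finer than (or equal to) the topology of pointwise convergence on $\mathcal F$, and write $\delta_x(f)=f(x)$ for $f\in\mathcal F$ and $x\in\Omega$. Then the following assertions are equivalent. (a) $(\mathcal F,\|\cdot\|)$ has a strongly unique isometric Banach predual. (b) For every isometric Banach predual $(Z,\varphi)$ of $(\mathcal F,\|\cdot\|)$ and every $x\in\Omega$ there is $z_x\in Z$ with $\delta_x=\varphi(\cdot)(z_x)$, that is, $f(x)=\varphi(f)(z_x)$ for all $f\in\mathcal F$. Moreover, for every isometric Banach predual $(Z,\varphi)$ of $(\mathcal F,\|\cdot\|)$ and every $x\in\Omega$ there is at most one such $z_x$. -/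

import Mathlib

universe u v w

section SaksSpaces

/-- The topology of the norm of `X`. -/
abbrev normTopology (X : Type u) [h : NormedAddCommGroup X] : TopologicalSpace X :=
  h.toMetricSpace.toPseudoMetricSpace.toUniformSpace.toTopologicalSpace

/-- `τ` is a linear topology (a topological vector space topology) on the `𝕜`-vector space `X`. -/
def IsVectorTopology (𝕜 : Type) [RCLike 𝕜] {X : Type u} [AddCommGroup X] [Module 𝕜 X]
    (τ : TopologicalSpace X) : Prop :=
  @IsTopologicalAddGroup X τ _ ∧ @ContinuousSMul 𝕜 X _ _ τ

/-- The set of all linear topologies `γ` on the normed space `X` which coincide with `τ` on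
norm-bounded sets and satisfy `τ ≤ γ ≤ τ_‖·‖` in the sense "coarser ≤ finer".
In Mathlib's order on `TopologicalSpace X` the finer topology is the smaller one. -/
def mixedTopologyCandidates (𝕜 : Type) [RCLike 𝕜] (X : Type u) [NormedAddCommGroup X]
    [NormedSpace 𝕜 X] (τ : TopologicalSpace X) : Set (TopologicalSpace X) :=
  {γ | IsVectorTopology 𝕜 γ ∧
    (∀ B : Set X, Bornology.IsBounded B →
      γ.induced (Subtype.val : B → X) = τ.induced (Subtype.val : B → X)) ∧
    γ ≤ τ ∧ normTopology X ≤ γ}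

/-- The mixed topology `γ(‖·‖, τ)`: the finest linear topology on `X` which coincides with `τ` on
norm-bounded sets and lies between `τ` and the norm topology. The infimum is attained, see
`isLeast_mixedTopology`. -/
@[reducible] def mixedTopology (𝕜 : Type) [RCLike 𝕜] (X : Type u) [NormedAddCommGroup X]
    [NormedSpace 𝕜 X] (τ : TopologicalSpace X) : TopologicalSpace X :=
  sInf (mixedTopologyCandidates 𝕜 X τ)

/-- For a linear topology `τ` coarser than the norm topology, the mixed topology is itself one of
the candidates, and it is the finest of them. -/
theorem isLeast_mixedTopology (𝕜 : Type) [RCLike 𝕜] (X : Type u) [NormedAddCommGroup X]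
    [NormedSpace 𝕜 X] (τ : TopologicalSpace X) (hτ : IsVectorTopology 𝕜 τ)
    (hle : normTopology X ≤ τ) :
    IsLeast (mixedTopologyCandidates 𝕜 X τ) (mixedTopology 𝕜 X τ) := by
  have hmem : τ ∈ mixedTopologyCandidates 𝕜 X τ := ⟨hτ, fun _ _ => rfl, le_rfl, hle⟩
  refine ⟨⟨⟨topologicalAddGroup_sInf fun t ht => ht.1.1, continuousSMul_sInf fun t ht => ht.1.2⟩,
    fun B hB => ?_, sInf_le hmem, le_sInf fun t ht => ht.2.2.2⟩, fun t ht => sInf_le ht⟩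
  rw [mixedTopology, induced_sInf]
  apply le_antisymm
  · exact sInf_le ⟨τ, hmem, rfl⟩
  · refine le_sInf ?_
    rintro _ ⟨t, ht, rfl⟩
    exact (ht.2.1 B hB).ge

/-- `(X, ‖·‖, τ)` is a Saks space: `τ` is a Hausdorff locally convex topology, coarser than the
norm topology, and there is a directed system `Γ` of seminorms generating `τ` (so that each of its
members is `τ`-continuous and `τ` is a locally convex linear topology) with
`‖x‖ = sup_{q ∈ Γ} q x` for all `x`. -/
structure IsSaksSpace (𝕜 : Type) [RCLike 𝕜] (X : Type u) [NormedAddCommGroup X]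
    [NormedSpace 𝕜 X] (τ : TopologicalSpace X) : Prop where
  t2 : @T2Space X τ
  coarser : normTopology X ≤ τ
  exists_seminorms : ∃ Γ : Set (Seminorm 𝕜 X), Γ.Nonempty ∧ DirectedOn (· ≤ ·) Γ ∧
    @WithSeminorms 𝕜 X Γ _ _ _ (fun q => (q : Seminorm 𝕜 X)) τ ∧
    ∀ x : X, IsLUB ((fun q : Seminorm 𝕜 X => q x) '' Γ) ‖x‖

/-- A locally convex Hausdorff space `X` is semi-reflexive if the canonical map from `X` into its
bidual `(X'_b)'` is onto. Here `StrongDual 𝕜 X` is the continuous dual with the topology of uniform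
convergence on bounded sets. -/
def IsSemiReflexive (𝕜 : Type) [RCLike 𝕜] (X : Type u) [AddCommGroup X] [Module 𝕜 X]
    [TopologicalSpace X] : Prop :=
  ∀ Φ : StrongDual 𝕜 (StrongDual 𝕜 X), ∃ x : X, ∀ f : StrongDual 𝕜 X, Φ f = f x

/-- `(X, ‖·‖, τ)` is a semi-reflexive Saks space: it is a Saks space, and `X` with the mixed
topology is semi-reflexive. -/
def IsSemiReflexiveSaksSpace (𝕜 : Type) [RCLike 𝕜] (X : Type u) [NormedAddCommGroup X]
    [NormedSpace 𝕜 X] (τ : TopologicalSpace X) : Prop :=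
  IsSaksSpace 𝕜 X τ ∧ @IsSemiReflexive 𝕜 _ X _ _ (mixedTopology 𝕜 X τ)

end SaksSpaces

section Preduals

/-- `X` is an isometric dual Banach space: it has an isometric Banach predual `(Y, φ)`, i.e.
`Y` is a Banach space and `φ : X → Y*` is an isometric isomorphism. Preduals may live in
any universe containing the one of `X`. -/
def IsIsometricDualBanach.{x, y} (𝕜 : Type) [RCLike 𝕜] (X : Type x) [NormedAddCommGroup X]
    [NormedSpace 𝕜 X] : Prop :=
  ∃ (Y : Type (max x y)) (_ : NormedAddCommGroup Y) (_ : NormedSpace 𝕜 Y) (_ : CompleteSpace Y),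
    Nonempty (X ≃ₗᵢ[𝕜] StrongDual 𝕜 Y)

/-- `X` has a strongly unique isometric Banach predual: `X` is an isometric dual Banach space, and
for all isometric Banach preduals `(Y, φ)`, `(Z, ψ)` of `X` and every isometric isomorphism
`α : Z* → Y*` there is an isometric isomorphism `l : Y → Z` with dual map `lᵗ = α`. -/
def HasStronglyUniqueIsometricPredual.{x, y} (𝕜 : Type) [RCLike 𝕜] (X : Type x)
    [NormedAddCommGroup X] [NormedSpace 𝕜 X] : Prop :=
  IsIsometricDualBanach.{x, y} 𝕜 X ∧
  ∀ (Y : Type (max x y)) [NormedAddCommGroup Y] [NormedSpace 𝕜 Y] [CompleteSpace Y]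
    (_ : X ≃ₗᵢ[𝕜] StrongDual 𝕜 Y)
    (Z : Type (max x y)) [NormedAddCommGroup Z] [NormedSpace 𝕜 Z] [CompleteSpace Z]
    (_ : X ≃ₗᵢ[𝕜] StrongDual 𝕜 Z)
    (α : StrongDual 𝕜 Z ≃ₗᵢ[𝕜] StrongDual 𝕜 Y),
    ∃ l : Y ≃ₗᵢ[𝕜] Z, ∀ (g : StrongDual 𝕜 Z) (y : Y), α g y = g (l y)

end Preduals

section PredualLemmas

variable {𝕜 : Type} [RCLike 𝕜]

/-! Via `predualEmbedding`, each predual of `F` is a closed subspace of `F*`; injectivity of the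
embedding makes `z_x` unique. If that subspace contains all point evaluations, it is their closed
span: they separate the points of `F = Z*`, so by Hahn-Banach the `z_x` are total in `Z`. All such
preduals thus have the same image, which gives (b) ⇒ (a). For the converse, one predual containing
the evaluations suffices, since strong uniqueness carries it onto any other. It is the norm closure
in `F*` of the dual of `F` under the mixed topology: the seminorms of the Saks space make `F` embed
isometrically in the dual of this closure, and semi-reflexivity makes the embedding onto. -/

theorem Submodule.topologicalClosure_eq_top_of_forall_dual {E : Type*} [NormedAddCommGroup E]
    [NormedSpace 𝕜 E] (M : Submodule 𝕜 E)
    (h : ∀ f : StrongDual 𝕜 E, (∀ m ∈ M, f m = 0) → f = 0) : M.topologicalClosure = ⊤ := by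
  rw [Submodule.eq_top_iff']
  intro x
  have hcl : IsClosed (M.topologicalClosure : Set E) := M.isClosed_topologicalClosure
  -- Makes the quotient by the closure Hausdorff, so that its dual separates points; functionals on
  -- it pull back to functionals vanishing on `M`.
  have : IsClosed (M.topologicalClosure.toAddSubgroup : Set E) := hcl
  rw [← Submodule.Quotient.mk_eq_zero]
  refine SeparatingDual.eq_zero_of_forall_dual_eq_zero (R := 𝕜) fun g => ?_
  have h0 := h (g.comp M.topologicalClosure.mkQL) fun m hm => by
    have : M.topologicalClosure.mkQ m = 0 :=
      (Submodule.Quotient.mk_eq_zero _).2 (M.le_topologicalClosure hm)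
    simpa using congrArg g this
  exact DFunLike.congr_fun h0 x

/-- **Hahn-Banach theorem**: a seminorm is attained at a point by a linear functional which it
dominates. -/
theorem Seminorm.exists_linearMap_norm_apply_eq {V : Type*} [AddCommGroup V] [Module 𝕜 V]
    (q : Seminorm 𝕜 V) (x : V) : ∃ y : V →ₗ[𝕜] 𝕜, ‖y x‖ = q x ∧ ∀ v, ‖y v‖ ≤ q v := by
  let : SeminormedAddCommGroup V := q.toSeminormedAddCommGroup
  let : NormedSpace 𝕜 V := ⟨fun c v => (map_smul_eq_mul q c v).le⟩
  obtain ⟨g, hg, hgx⟩ := exists_dual_vector'' 𝕜 x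
  refine ⟨g.toLinearMap, ?_, fun v => ?_⟩
  · change ‖g x‖ = ‖x‖
    simp [hgx]
  · exact (g.le_opNorm v).trans (mul_le_of_le_one_left (norm_nonneg v) hg)

variable {F : Type*} [NormedAddCommGroup F] [NormedSpace 𝕜 F]
  {Y : Type*} [NormedAddCommGroup Y] [NormedSpace 𝕜 Y]
  {Z : Type*} [NormedAddCommGroup Z] [NormedSpace 𝕜 Z]

/-- The isometric embedding `z ↦ φ(·)(z)` of a predual into the dual. -/
noncomputable def predualEmbedding (φ : F ≃ₗᵢ[𝕜] StrongDual 𝕜 Z) : Z →ₗᵢ[𝕜] StrongDual 𝕜 F where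
  toLinearMap := (ContinuousLinearMap.precomp 𝕜
    (φ : F →L[𝕜] StrongDual 𝕜 Z)).toLinearMap ∘ₗ
      (NormedSpace.inclusionInDoubleDualLi (E := Z) 𝕜).toLinearMap
  norm_map' z := by
    rw [← (NormedSpace.inclusionInDoubleDualLi (E := Z) 𝕜).norm_map z]
    exact ContinuousLinearMap.opNorm_comp_linearIsometryEquiv _ φ

@[simp]
theorem predualEmbedding_apply (φ : F ≃ₗᵢ[𝕜] StrongDual 𝕜 Z) (z : Z) (f : F) :
    predualEmbedding φ z f = φ f z := rfl

theorem eq_of_forall_predual_apply_eq (φ : F ≃ₗᵢ[𝕜] StrongDual 𝕜 Z) {z z' : Z}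
    (h : ∀ f, φ f z = φ f z') : z = z' :=
  (predualEmbedding φ).injective (ContinuousLinearMap.ext h)

/-- Two preduals with the same image in the dual are isometric, compatibly with the
representations of `F`. -/
theorem exists_linearIsometryEquiv_of_range_eq (φ : F ≃ₗᵢ[𝕜] StrongDual 𝕜 Y)
    (ψ : F ≃ₗᵢ[𝕜] StrongDual 𝕜 Z)
    (h : LinearMap.range (predualEmbedding φ).toLinearMap =
      LinearMap.range (predualEmbedding ψ).toLinearMap) :
    ∃ l : Y ≃ₗᵢ[𝕜] Z, ∀ f y, φ f y = ψ f (l y) := by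
  refine ⟨((predualEmbedding φ).equivRange.trans (LinearIsometryEquiv.ofEq _ _ h)).trans
    (predualEmbedding ψ).equivRange.symm, fun f y => ?_⟩
  rw [← predualEmbedding_apply φ, ← predualEmbedding_apply ψ]
  congr 1
  have := (predualEmbedding ψ).equivRange.apply_symm_apply
    (LinearIsometryEquiv.ofEq _ _ h ((predualEmbedding φ).equivRange y))
  exact (congrArg Subtype.val this).symm

/-- A predual whose image contains a total set of functionals is the closed span of that set. -/
theorem range_predualEmbedding_eq_closure_span [CompleteSpace Z] {Ω : Type*}
    (δ : Ω → StrongDual 𝕜 F) (hδ : ∀ f, (∀ x, δ x f = 0) → f = 0)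
    (φ : F ≃ₗᵢ[𝕜] StrongDual 𝕜 Z) (h : ∀ x, ∃ z, predualEmbedding φ z = δ x) :
    LinearMap.range (predualEmbedding φ).toLinearMap =
      (Submodule.span 𝕜 (Set.range δ)).topologicalClosure := by
  choose z hz using h
  have hclosed : IsClosed (LinearMap.range (predualEmbedding φ).toLinearMap :
      Set (StrongDual 𝕜 F)) :=
    (predualEmbedding φ).isometry.isClosedEmbedding.isClosed_range
  apply le_antisymm
  · rintro _ ⟨y, rfl⟩
    have htop : (Submodule.span 𝕜 (Set.range z)).topologicalClosure = ⊤ := by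
      refine Submodule.topologicalClosure_eq_top_of_forall_dual _ fun g hg => ?_
      -- A functional on `Z` that kills every `z x` is `φ f` for some `f` killed by every `δ x`.
      obtain ⟨f, rfl⟩ := φ.surjective g
      rw [hδ f fun x => ?_, map_zero]
      rw [← hz, predualEmbedding_apply]
      exact hg _ (Submodule.subset_span ⟨x, rfl⟩)
    have hy : y ∈ (Submodule.span 𝕜 (Set.range z)).topologicalClosure := htop ▸ Submodule.mem_top
    refine map_mem_closure (predualEmbedding φ).continuous hy fun m hm => ?_
    have := Submodule.mem_map_of_mem (f := (predualEmbedding φ).toLinearMap) hm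
    rw [Submodule.map_span, ← Set.range_comp] at this
    rwa [← show _ ∘ z = δ from funext hz]
  · refine Submodule.topologicalClosure_minimal _ (Submodule.span_le.2 ?_) hclosed
    rintro _ ⟨x, rfl⟩
    exact ⟨z x, hz x⟩

end PredualLemmas

/-- If a normed space maps continuously onto a semi-reflexive space `E` whose dual is norming, then
it has an isometric Banach predual which contains the dual of `E`. -/
theorem exists_predual_of_isSemiReflexive {𝕜 : Type} [RCLike 𝕜]
    {F : Type u} [NormedAddCommGroup F] [NormedSpace 𝕜 F]
    {E : Type*} [AddCommGroup E] [Module 𝕜 E] [TopologicalSpace E]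
    (hE : IsSemiReflexive 𝕜 E) (ι : F →L[𝕜] E) (hι : Function.Surjective ι)
    (hn : ∀ x : F, ∀ c < ‖x‖, ∃ y : StrongDual 𝕜 E, (∀ v, ‖y (ι v)‖ ≤ ‖v‖) ∧ c < ‖y (ι x)‖) :
    ∃ (Z : Type (max u w)) (_ : NormedAddCommGroup Z) (_ : NormedSpace 𝕜 Z) (_ : CompleteSpace Z)
      (φ : F ≃ₗᵢ[𝕜] StrongDual 𝕜 Z), ∀ y : StrongDual 𝕜 E, ∃ z, ∀ f, y (ι f) = φ f z := by
  -- Restriction is continuous for the strong topology because `ι` preserves bounded sets; this lets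
  -- semi-reflexivity be applied to functionals on `P`.
  let R : StrongDual 𝕜 E →L[𝕜] StrongDual 𝕜 F := ContinuousLinearMap.precomp 𝕜 ι
  let P : Submodule 𝕜 (StrongDual 𝕜 F) := (LinearMap.range R.toLinearMap).topologicalClosure
  have hP : ∀ y, R y ∈ P := fun y => Submodule.le_topologicalClosure _ ⟨y, rfl⟩
  have : CompleteSpace P := (Submodule.isClosed_topologicalClosure _).completeSpace_coe
  suffices key : ∀ (Z : Type (max u w)) [NormedAddCommGroup Z] [NormedSpace 𝕜 Z] (_ : Z ≃ₗᵢ[𝕜] P),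
      ∃ φ : F ≃ₗᵢ[𝕜] StrongDual 𝕜 Z, ∀ y : StrongDual 𝕜 E, ∃ z, ∀ f, y (ι f) = φ f z by
    -- `P` lives in universe `u`, the required predual in `max u w`.
    let e : ULift.{w} P ≃ₗᵢ[𝕜] P := LinearIsometryEquiv.ulift 𝕜 P
    have hc : CompleteSpace (ULift.{w} P) :=
      (completeSpace_congr (e := e.toEquiv) e.isometry.isUniformEmbedding).2 this
    exact ⟨ULift.{w} P, inferInstance, inferInstance, hc, key _ e⟩
  intro Z _ _ e
  let J : Z →L[𝕜] StrongDual 𝕜 F := P.subtypeL.comp (e : Z →L[𝕜] P)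
  have hJ : ∀ z, ‖J z‖ = ‖z‖ := fun z => e.norm_map z
  let T : F →L[𝕜] StrongDual 𝕜 Z :=
    (ContinuousLinearMap.precomp 𝕜 J).comp (NormedSpace.inclusionInDoubleDual 𝕜 F)
  have hT : ∀ x z, T x z = J z x := fun _ _ => rfl
  have hnorm : ∀ x, ‖T x‖ = ‖x‖ := by
    intro x
    apply le_antisymm
    · refine ContinuousLinearMap.opNorm_le_bound _ (norm_nonneg _) fun z => ?_
      rw [hT, mul_comm, ← hJ]
      exact (J z).le_opNorm x
    · refine le_of_forall_lt fun c hcx => ?_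
      obtain ⟨y, hy, hyx⟩ := hn x c hcx
      have hy1 : ‖R y‖ ≤ 1 :=
        ContinuousLinearMap.opNorm_le_bound _ zero_le_one fun v => by simpa [R] using hy v
      refine hyx.trans_le ?_
      have := (T x).unit_le_opNorm (e.symm ⟨R y, hP y⟩)
        ((e.symm.norm_map _).trans_le hy1)
      simpa [hT, J, R] using this
  have hsurj : Function.Surjective T := by
    intro Φ
    let Φ' : StrongDual 𝕜 P := Φ.comp (e.symm : P →L[𝕜] Z)
    obtain ⟨a, ha⟩ := hE (Φ'.comp (R.codRestrict P hP))
    obtain ⟨x, rfl⟩ := hι a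
    refine ⟨x, ?_⟩
    -- Both sides are continuous in `p` and agree on the range of `R`, which is dense in `P`.
    have hext : ∀ p : P, (p : StrongDual 𝕜 F) x = Φ' p := by
      have hd : DenseRange (R.codRestrict P hP) := by
        rw [DenseRange, Subtype.dense_iff]
        intro p hp
        refine closure_mono ?_ hp
        rintro _ ⟨y, rfl⟩
        exact ⟨⟨R y, hP y⟩, ⟨y, rfl⟩, rfl⟩
      have heq := hd.equalizer (g := fun p : P => (p : StrongDual 𝕜 F) x) (h := Φ')
        ((NormedSpace.inclusionInDoubleDual 𝕜 F x).continuous.comp continuous_subtype_val)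
        Φ'.continuous (funext fun y => (ha y).symm)
      exact congrFun heq
    ext z
    have h := hext (e z)
    change (e z : StrongDual 𝕜 F) x = Φ (e.symm (e z)) at h
    rwa [e.symm_apply_apply] at h
  exact ⟨LinearIsometryEquiv.ofSurjective ⟨T.toLinearMap, hnorm⟩ hsurj, fun y =>
    ⟨e.symm ⟨R y, hP y⟩, fun f => by simp [hT, J, R]⟩⟩

/-- A semi-reflexive Saks space has an isometric Banach predual which contains all functionals
that are `τ`-continuous. -/
theorem IsSemiReflexiveSaksSpace.exists_predual {𝕜 : Type} [RCLike 𝕜]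
    {F : Type u} [NormedAddCommGroup F] [NormedSpace 𝕜 F] {τ : TopologicalSpace F}
    (hτ : IsSemiReflexiveSaksSpace 𝕜 F τ) :
    ∃ (Z : Type (max u w)) (_ : NormedAddCommGroup Z) (_ : NormedSpace 𝕜 Z) (_ : CompleteSpace Z)
      (φ : F ≃ₗᵢ[𝕜] StrongDual 𝕜 Z), ∀ y : F →ₗ[𝕜] 𝕜, @Continuous F 𝕜 τ _ y →
        ∃ z, ∀ f, y f = φ f z := by
  obtain ⟨⟨-, hle, Γ, -, -, hΓ, hlub⟩, hsr⟩ := hτ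
  have hvec : IsVectorTopology 𝕜 τ :=
    ⟨@WithSeminorms.topologicalAddGroup _ _ _ _ _ _ τ _ hΓ,
      WithSeminorms.continuousSMul hΓ⟩
  have hleast := (isLeast_mixedTopology 𝕜 F τ hvec hle).1
  obtain ⟨-, -, hγτ, hnγ⟩ := hleast
  let ι : @ContinuousLinearMap 𝕜 𝕜 _ _ (RingHom.id 𝕜) F (normTopology F) _ F
      (mixedTopology 𝕜 F τ) _ _ _ :=
    @ContinuousLinearMap.mk 𝕜 𝕜 _ _ (RingHom.id 𝕜) F (normTopology F) _ F
      (mixedTopology 𝕜 F τ) _ _ _ LinearMap.id (continuous_id_iff_le.2 hnγ)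
  have toγ : ∀ y : F →ₗ[𝕜] 𝕜, @Continuous F 𝕜 τ _ y →
      @Continuous F 𝕜 (mixedTopology 𝕜 F τ) _ y := fun y hy => continuous_le_dom hγτ hy
  obtain ⟨Z, i1, i2, i3, φ, hφ⟩ := @exists_predual_of_isSemiReflexive.{u, w} 𝕜 _ F _ _ F _ _
    (mixedTopology 𝕜 F τ) hsr ι Function.surjective_id (by
      intro x c hc
      -- A functional dominated by a single `q ∈ Γ` is `τ`-continuous and, as `q ≤ ‖·‖`, has norm at
      -- most one.
      obtain ⟨_, ⟨q, hq, rfl⟩, hcq, -⟩ := (hlub x).exists_between hc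
      obtain ⟨y, hyx, hyq⟩ := q.exists_linearMap_norm_apply_eq x
      have hyc : @Continuous F 𝕜 τ _ y := by
        refine WithSeminorms.continuous_normedSpace_rng 𝕜 hΓ y
          ⟨{⟨q, hq⟩}, 1, fun v => ?_⟩
        simpa using hyq v
      refine ⟨@ContinuousLinearMap.mk 𝕜 𝕜 _ _ (RingHom.id 𝕜) F
        (mixedTopology 𝕜 F τ) _ 𝕜 _ _ _ _ y (toγ y hyc), fun v => ?_, ?_⟩
      · exact (hyq v).trans ((hlub v).1 ⟨q, hq, rfl⟩)
      · exact hcq.trans_eq hyx.symm)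
  exact ⟨Z, i1, i2, i3, φ, fun y hy => hφ (@ContinuousLinearMap.mk 𝕜 𝕜 _ _ (RingHom.id 𝕜) F
    (mixedTopology 𝕜 F τ) _ 𝕜 _ _ _ _ y (toγ y hy))⟩

/-- A space of functions with a predual containing the point evaluations has a strongly unique
predual if and only if all of its preduals contain the point evaluations. -/
theorem hasStronglyUniqueIsometricPredual_iff {𝕜 : Type} [RCLike 𝕜] {Ω : Type v}
    {F : Type u} [NormedAddCommGroup F] [NormedSpace 𝕜 F]
    (ev : F →ₗ[𝕜] (Ω → 𝕜)) (hev : Function.Injective ev)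
    {Y : Type (max u w)} [NormedAddCommGroup Y] [NormedSpace 𝕜 Y] [CompleteSpace Y]
    (φY : F ≃ₗᵢ[𝕜] StrongDual 𝕜 Y) (hY : ∀ x, ∃ y, ∀ f, ev f x = φY f y) :
    HasStronglyUniqueIsometricPredual.{u, w} 𝕜 F ↔
      ∀ (Z : Type (max u w)) [NormedAddCommGroup Z] [NormedSpace 𝕜 Z] [CompleteSpace Z]
        (φ : F ≃ₗᵢ[𝕜] StrongDual 𝕜 Z) (x : Ω), ∃ z : Z, ∀ f : F, ev f x = φ f z := by
  refine ⟨fun h Z _ _ _ φ x => ?_, fun h => ⟨⟨Y, _, _, ‹_›, ⟨φY⟩⟩, ?_⟩⟩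
  · obtain ⟨l, hl⟩ := h.2 Y φY Z φ (φ.symm.trans φY)
    obtain ⟨y, hy⟩ := hY x
    refine ⟨l y, fun f => (hy f).trans ?_⟩
    simpa using hl (φ f) y
  · intro W _ _ _ φ Z _ _ _ ψ α
    choose y hy using hY
    let δ : Ω → StrongDual 𝕜 F := fun x => predualEmbedding φY (y x)
    have hδ : ∀ f, (∀ x, δ x f = 0) → f = 0 := fun f hf =>
      hev (by rw [map_zero]; exact funext fun x => (hy x f).trans (hf x))
    have hmem : ∀ (W : Type (max u w)) [NormedAddCommGroup W] [NormedSpace 𝕜 W] [CompleteSpace W]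
        (χ : F ≃ₗᵢ[𝕜] StrongDual 𝕜 W) (x : Ω), ∃ z, predualEmbedding χ z = δ x := by
      intro W _ _ _ χ x
      obtain ⟨z, hz⟩ := h W χ x
      exact ⟨z, ContinuousLinearMap.ext fun f => (hz f).symm.trans (hy x f)⟩
    -- Representing `F` on `W*` by `α ∘ ψ` turns compatibility of `l` with the two representations
    -- into `lᵗ = α`.
    obtain ⟨l, hl⟩ := exists_linearIsometryEquiv_of_range_eq (ψ.trans α) ψ
      ((range_predualEmbedding_eq_closure_span δ hδ _ (hmem W _)).trans
        (range_predualEmbedding_eq_closure_span δ hδ _ (hmem Z _)).symm)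
    refine ⟨l, fun g y => ?_⟩
    simpa using hl (ψ.symm g) y

/-- A normed space of `𝕜`-valued functions on `Ω` is given by a normed space `F` together with an
injective linear map `ev : F → (Ω → 𝕜)`, through which its elements are read as functions;
the point evaluation at `x` is `f ↦ ev f x`. -/
theorem corollary5 {𝕜 : Type} [RCLike 𝕜] {Ω : Type v} [Nonempty Ω]
    {F : Type u} [NormedAddCommGroup F] [NormedSpace 𝕜 F]
    (ev : F →ₗ[𝕜] (Ω → 𝕜)) (hev : Function.Injective ev)
    (τ : TopologicalSpace F) (hτ : IsSemiReflexiveSaksSpace 𝕜 F τ)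
    (hp : τ ≤ TopologicalSpace.induced ev Pi.topologicalSpace) :
    (HasStronglyUniqueIsometricPredual.{u, w} 𝕜 F ↔
      ∀ (Z : Type (max u w)) [NormedAddCommGroup Z] [NormedSpace 𝕜 Z] [CompleteSpace Z]
        (φ : F ≃ₗᵢ[𝕜] StrongDual 𝕜 Z) (x : Ω), ∃ z : Z, ∀ f : F, ev f x = φ f z) ∧
    (∀ (Z : Type (max u w)) [NormedAddCommGroup Z] [NormedSpace 𝕜 Z] [CompleteSpace Z]
        (φ : F ≃ₗᵢ[𝕜] StrongDual 𝕜 Z) (x : Ω) (z z' : Z),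
        (∀ f : F, ev f x = φ f z) → (∀ f : F, ev f x = φ f z') → z = z') := by
  have hτev : ∀ x, @Continuous F 𝕜 τ _ (LinearMap.proj x ∘ₗ ev) := fun x =>
    continuous_le_dom hp (@Continuous.comp _ _ _ (.induced ev Pi.topologicalSpace) _ _ ev
      (fun g => g x) (continuous_apply x) continuous_induced_dom)
  obtain ⟨Y, _, _, _, φY, hY⟩ := IsSemiReflexiveSaksSpace.exists_predual.{u, w} hτ
  refine ⟨hasStronglyUniqueIsometricPredual_iff ev hev φY fun x => hY _ (hτev x), ?_⟩
  intro Z _ _ _ φ x z z' hz hz'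
  exact eq_of_forall_predual_apply_eq φ fun f => (hz f).symm.trans (hz' f)
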